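/- Let $d_0,d_1\ge 3$ be integers and let $T$ be a $(d_0,d_1)$-semi-regular tree, i.e. a tree whose vertex set has a partition $V(T)=V_0\sqcup V_1$ such that every edge has exactly one endpoint in each $V_i$ and every vertex of $V_i$ has degree $d_i$. Equip $\mathrm{Aut}(T)$ with the topology of pointwise convergence on the discrete set $V(T)$, and let $G\le\mathrm{Aut}(T)$ be a closed, non-compact subgroup acting transitively on the boundary $\partial T$ (the set of infinite rays of $T$, two rays being identified when they eventually coincide up to a shift). Let $v\in V(T)$, and for $n\ge 1$ let $$K_n=\mathrm{Fix}_G(B_T(v,n))=\{g\in G : gx=x \text{ for every vertex } x \text{ with } d_T(v,x)\le n\}.$$ A representation of $G$ means a strongly continuous unitary representation $\pi$ on a separable complex Hilbert space $\mathcal H_\pi$; it is called spherical if it is irreducible and there is a vertex $w\in V(T)$ such that $\mathcal H_\pi$ contains a non-zero vector invariant under $\mathrm{Fix}_G(w)=\{g\in G: gw=w\}$. For a subgroup $K\le G$, $\mathcal H_\pi^{K}$ denotes the space of $K$-invariant vectors. Then for every integer $n\ge 1$ there exists a constant $k_n\in\mathbb N$ such that $$\dim\big(\mathcal H_\pi^{K_n}\big)<k_n$$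 for every spherical representation $\pi$ of $G$ admitting a non-zero $\mathrm{Fix}_G(v)$-invariant vector. -/

import Mathlib

/-! ### Automorphism groups of trees -/

universe u w

namespace TreeRep

/-- The bipartition `V = V₀ ⊔ V₁` witnesses `(d₀, d₁)`-semi-regularity: every edge has exactly one
vertex in each `Vᵢ`, and each vertex of `Vᵢ` has degree `dᵢ`. -/
structure IsSemiRegularBipartition {V : Type u} (T : SimpleGraph V) (d₀ d₁ : ℕ)
    (V₀ V₁ : Set V) : Prop where
  bipartite : T.IsBipartiteWith V₀ V₁
  cover : V₀ ∪ V₁ = Set.univ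
  degree₀ : ∀ v ∈ V₀, (T.neighborSet v).encard = d₀
  degree₁ : ∀ v ∈ V₁, (T.neighborSet v).encard = d₁

/-- A `(d₀, d₁)`-semi-regular tree. -/
def IsSemiRegularTree {V : Type u} (T : SimpleGraph V) (d₀ d₁ : ℕ) : Prop :=
  T.IsTree ∧ ∃ V₀ V₁ : Set V, IsSemiRegularBipartition T d₀ d₁ V₀ V₁

/-- The topology of pointwise convergence on `Aut(T)`, the vertex set being discrete. -/
instance autTopology {V : Type u} (T : SimpleGraph V) : TopologicalSpace (T ≃g T) :=
  TopologicalSpace.induced (fun (g : T ≃g T) (v : V) => g v)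
    (@Pi.topologicalSpace V (fun _ => V) (fun _ => ⊥))

/-- The ball `B_T(v, n)` of all vertices at distance at most `n` from `v`. -/
def closedBall {V : Type u} (T : SimpleGraph V) (v : V) (n : ℕ) : Set V :=
  {x | T.dist v x ≤ n}

/-! ### The boundary of a tree -/

/-- A ray: an infinite path without repetition (in a tree, the same as a geodesic ray). -/
structure Ray {V : Type u} (T : SimpleGraph V) where
  vertex : ℕ → V
  adj : ∀ n, T.Adj (vertex n) (vertex (n + 1))
  injective : Function.Injective vertex

/-- The image of a ray under an automorphism. -/
def Ray.map {V : Type u} {T : SimpleGraph V} (g : T ≃g T) (r : Ray T) : Ray T where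
  vertex n := g (r.vertex n)
  adj n := g.map_rel_iff.2 (r.adj n)
  injective := g.injective.comp r.injective

/-- Two rays are cofinal when they agree from some point on, up to a shift of the parameter. -/
def Ray.Cofinal {V : Type u} {T : SimpleGraph V} (r s : Ray T) : Prop :=
  ∃ a b : ℕ, ∀ n, r.vertex (a + n) = s.vertex (b + n)

/-- Cofinality is an equivalence relation. -/
instance raySetoid {V : Type u} (T : SimpleGraph V) : Setoid (Ray T) where
  r := Ray.Cofinal
  iseqv :=
    { refl := fun _ => ⟨0, 0, fun _ => rfl⟩
      symm := fun ⟨a, b, h⟩ => ⟨b, a, fun n => (h n).symm⟩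
      trans := fun {r s t} ⟨a, b, h⟩ ⟨c, d, k⟩ => by
        refine ⟨a + c, d + b, fun n => ?_⟩
        have h₁ := h (c + n)
        have h₂ := k (b + n)
        rw [show a + c + n = a + (c + n) by omega, h₁,
          show b + (c + n) = c + (b + n) by omega, h₂,
          show d + (b + n) = d + b + n by omega] }

/-- The boundary `∂T`: rays up to cofinality. -/
def Boundary {V : Type u} (T : SimpleGraph V) : Type u := Quotient (raySetoid T)

/-- The action of `Aut(T)` on `∂T`. -/
instance boundaryAction {V : Type u} (T : SimpleGraph V) : MulAction (T ≃g T) (Boundary T) where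
  smul g := Quotient.map (Ray.map g) fun _ _ ⟨a, b, h⟩ => ⟨a, b, fun n => congrArg g (h n)⟩
  one_smul x := Quotient.inductionOn x fun _ => rfl
  mul_smul _ _ x := Quotient.inductionOn x fun _ => rfl

/-! ### Unitary representations -/

/-- A strongly continuous unitary representation of `G` on the complex Hilbert space `H`. -/
structure UnitaryRep (G : Type u) [Group G] [TopologicalSpace G] (H : Type w)
    [NormedAddCommGroup H] [InnerProductSpace ℂ H] [CompleteSpace H] where
  toHom : G →* unitary (H →L[ℂ] H)
  continuous_orbit : ∀ x : H, Continuous fun g : G => (toHom g : H →L[ℂ] H) x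

/-- The space `H^K` of `K`-invariant vectors. -/
def UnitaryRep.invariants {G : Type u} [Group G] [TopologicalSpace G] {H : Type w}
    [NormedAddCommGroup H] [InnerProductSpace ℂ H] [CompleteSpace H]
    (π : UnitaryRep G H) (K : Subgroup G) : Submodule ℂ H where
  carrier := {x | ∀ g ∈ K, (π.toHom g : H →L[ℂ] H) x = x}
  zero_mem' _ _ := map_zero _
  add_mem' hx hy g hg := by rw [map_add, hx g hg, hy g hg]
  smul_mem' c x hx g hg := by rw [map_smul, hx g hg]

/-- Irreducibility: `H` is non-zero and has no closed invariant subspaces besides `0` and `H`. -/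
def UnitaryRep.IsIrreducible {G : Type u} [Group G] [TopologicalSpace G] {H : Type w}
    [NormedAddCommGroup H] [InnerProductSpace ℂ H] [CompleteSpace H]
    (π : UnitaryRep G H) : Prop :=
  Nontrivial H ∧ ∀ W : Submodule ℂ H, IsClosed (W : Set H) →
    (∀ (g : G), ∀ x ∈ W, (π.toHom g : H →L[ℂ] H) x ∈ W) → W = ⊥ ∨ W = ⊤

/-- A representation of `G ≤ Aut(T)` is spherical if it is irreducible and has a non-zero vector
invariant under the stabilizer of some vertex. -/
def IsSpherical {V : Type u} {T : SimpleGraph V} {G : Subgroup (T ≃g T)} {H : Type w}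
    [NormedAddCommGroup H] [InnerProductSpace ℂ H] [CompleteSpace H]
    (π : UnitaryRep G H) : Prop :=
  π.IsIrreducible ∧ ∃ v : V, π.invariants (MulAction.stabilizer G v) ≠ ⊥

end TreeRep

/-!
The constant comes from an eigenvalue equation on the tree. Let `K` be the stabilizer of `v`, let
`L` be the pointwise stabilizer of the ball, and let `ξ` be a non-zero `K`-fixed vector.

*Orbits.* The subgroup `L` has countable index in `G`, so by a Baire category argument carried out
with shadows of vertices (`exists_shadow_subset_orbit`) the closure of each of its orbits on
the boundary is a neighbourhood of the points of the orbit, and König's lemma gives a level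
`M` beyond which vertices of equal level behind a common vertex are `L`-conjugate
(`exists_level_conjugate`). Applied to the stabilizer
of a vertex instead of `L`, the same statement shows that vertex stabilizers are transitive on
spheres (`exists_mem_stabilizer_smul_eq`): as `G` is closed and not compact, its orbits go to
infinity in every direction, and two points of a sphere around `y` lie behind `y` as seen from a far
away point of the orbit of `y` in a third direction.

*Uniqueness of the spherical vector.* Transitivity on spheres gives `g⁻¹ ∈ K g K`. So the
compressions of the operators `π g` to the `K`-fixed vectors are self-adjoint, and so are their
products, which are averages of such compressions; hence they commute, and by irreducibility and the
functional calculus they are scalars. Thus `ξ` is unique up to scalars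
(`UnitaryRep.IsIrreducible.exists_eq_smul`), and no integration over `K` is needed.

*The eigenfunction.* The function `g • v ↦ π g ξ`, extended to a possible second orbit of vertices
by summation over neighbours, has a total value over the neighbours of each vertex `x` that is a
multiple of its value at `x` (`UnitaryRep.exists_sum_eigenfunction_eq_smul`). Its projection to the
`L`-fixed vectors satisfies the same equation and is constant on `L`-orbits. Beyond level `M` all
children of a vertex carry the same value, which the equation expresses by the values at the vertex
and its parent (`mem_span_of_eigenfunction`). Therefore the values on the ball of radius `M + 1`
span the space of `L`-fixed vectors, and its dimension is at most the number of vertices in this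
ball, which does not depend on `π`.
-/

namespace TreeRep

/-! ### Geometry of trees -/

section Tree

variable {V : Type u} {T : SimpleGraph V}

/-- The shadow of `b` seen from `v`: the vertices `z` such that `b` lies on the geodesic from `v`
to `z`. -/
def shadow (T : SimpleGraph V) (v b : V) : Set V := {z | T.dist v z = T.dist v b + T.dist b z}

theorem mem_shadow {v b z : V} : z ∈ shadow T v b ↔ T.dist v z = T.dist v b + T.dist b z := Iff.rfl

theorem exists_adj_toward (hT : T.IsTree) {x y : V} (h : x ≠ y) :
    ∃ a, T.Adj y a ∧ T.dist x y = T.dist x a + 1 := by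
  obtain ⟨p, hp⟩ := hT.connected.exists_walk_length_eq_dist y x
  cases p with
  | nil => exact absurd rfl h
  | @cons _ a _ hya q =>
    refine ⟨a, hya, ?_⟩
    have h1 := T.dist_le q
    have h2 := hya.diff_dist_adj (u := x)
    rw [SimpleGraph.Walk.length_cons] at hp
    have h3 := T.dist_comm (u := x) (v := y)
    have h4 := T.dist_comm (u := x) (v := a)
    omega

/-- The neighbour of `y` that lies closer to `x` is unique. -/
theorem eq_of_adj_toward (hT : T.IsTree) {x y a b : V} (ha : T.Adj y a) (hb : T.Adj y b)
    (hda : T.dist x y = T.dist x a + 1) (hdb : T.dist x y = T.dist x b + 1) : a = b := by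
  obtain ⟨p, hp⟩ := hT.connected.exists_walk_length_eq_dist x a
  obtain ⟨q, hq⟩ := hT.connected.exists_walk_length_eq_dist x b
  have hp' := (p.concat ha.symm).isPath_of_length_eq_dist (by
    rw [SimpleGraph.Walk.length_concat, hp, hda])
  have hq' := (q.concat hb.symm).isPath_of_length_eq_dist (by
    rw [SimpleGraph.Walk.length_concat, hq, hdb])
  have h := congrArg Subtype.val
    ((hT.isAcyclic.subsingleton_path x y).elim ⟨_, hp'⟩ ⟨_, hq'⟩)
  have h' := congrArg SimpleGraph.Walk.penultimate h
  simpa using h'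

/-- If `x` and `z` lie in different directions at `y`, then `y` lies on the geodesic from `x` to
`z`. -/
theorem mem_shadow_of_adj_ne (hT : T.IsTree) {x y z a b : V} (ha : T.Adj y a) (hb : T.Adj y b)
    (hab : a ≠ b) (hx : T.dist x y = T.dist x a + 1) (hz : T.dist z y = T.dist z b + 1) :
    z ∈ shadow T x y := by
  have key : ∀ n z, T.dist z y = n + 1 → T.dist z b = n → T.dist x z = T.dist x y + n + 1 := by
    intro n
    induction n with
    | zero =>
      intro z _ hz
      obtain rfl := hT.connected.dist_eq_zero_iff.1 hz
      rcases hT.dist_eq_dist_add_one_of_adj x hb with h | h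
      · exact absurd (eq_of_adj_toward hT ha hb hx h) hab
      · omega
    | succ n ih =>
      intro z hzy hzb
      have hne : b ≠ z := by rintro rfl; simp at hzb
      obtain ⟨z', hzz', hd⟩ := exists_adj_toward hT hne
      have hz'b : T.dist z' b = n := by
        rw [T.dist_comm]; rw [T.dist_comm] at hzb; omega
      have hz'y : T.dist z' y = n + 1 := by
        have h1 := hT.connected.dist_triangle (u := z') (v := b) (w := y)
        have h2 := hT.connected.dist_triangle (u := z) (v := z') (w := y)
        rw [SimpleGraph.dist_eq_one_iff_adj.2 hb.symm] at h1
        rw [SimpleGraph.dist_eq_one_iff_adj.2 hzz'] at h2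
        omega
      have hxz' := ih z' hz'y hz'b
      rcases hT.dist_eq_dist_add_one_of_adj x hzz' with h | h
      · omega
      · have hne' : y ≠ z' := by rintro rfl; simp at hz'y
        obtain ⟨t, ht, hdt⟩ := exists_adj_toward hT hne'
        have h1 := hT.connected.dist_triangle (u := x) (v := y) (w := t)
        have h2 := hT.dist_eq_dist_add_one_of_adj x ht
        have h3 := T.dist_comm (u := y) (v := z')
        have hzt : z = t := eq_of_adj_toward hT hzz'.symm ht h (by omega)
        subst hzt
        have h4 := T.dist_comm (u := y) (v := z)
        omega
  have := key (T.dist z b) z hz rfl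
  rw [mem_shadow, this, T.dist_comm (u := y), hz, add_assoc]

theorem self_mem_shadow (v b : V) : b ∈ shadow T v b := by simp [mem_shadow]

theorem mem_shadow_self (v z : V) : z ∈ shadow T v v := by simp [mem_shadow]

theorem mem_shadow_comm {v b z : V} : z ∈ shadow T v b ↔ v ∈ shadow T z b := by
  rw [mem_shadow, mem_shadow, T.dist_comm (u := v) (v := z), T.dist_comm (u := v) (v := b),
    T.dist_comm (u := z) (v := b), add_comm]

theorem shadow_subset_shadow (hT : T.IsTree) {v b c : V} (h : c ∈ shadow T v b) :
    shadow T v c ⊆ shadow T v b := by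
  intro z hz
  rw [mem_shadow] at *
  have h1 := hT.connected.dist_triangle (u := b) (v := c) (w := z)
  have h2 := hT.connected.dist_triangle (u := v) (v := b) (w := z)
  omega

/-- The tripod property of trees: a point on a geodesic from `v` to `z` lies, for every `u`, on
the geodesic from `v` to `u` or on the one from `u` to `z`. -/
theorem mem_shadow_or_mem_shadow (hT : T.IsTree) {v b z : V} (h : z ∈ shadow T v b) (u : V) :
    u ∈ shadow T v b ∨ z ∈ shadow T u b := by
  by_cases hv : v = b
  · subst hv; exact Or.inl (mem_shadow_self _ _)
  by_cases hz : z = b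
  · subst hz; exact Or.inr (self_mem_shadow _ _)
  by_cases hu : u = b
  · subst hu; exact Or.inl (self_mem_shadow _ _)
  obtain ⟨a, ha, hda⟩ := exists_adj_toward hT hv
  obtain ⟨c, hc, hdc⟩ := exists_adj_toward hT hz
  obtain ⟨e, he, hde⟩ := exists_adj_toward hT hu
  by_cases hae : a = e
  · right
    subst hae
    refine mem_shadow_of_adj_ne hT he hc ?_ hde hdc
    rintro rfl
    rw [mem_shadow] at h
    have h1 := hT.connected.dist_triangle (u := v) (v := a) (w := z)
    rw [T.dist_comm (u := a) (v := z)] at h1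
    rw [T.dist_comm (u := b) (v := z)] at h
    omega
  · exact Or.inl (mem_shadow_of_adj_ne hT ha he hae hda hde)

/-- A shadow does not depend on the observer as long as the observer stays outside of it. -/
theorem shadow_eq_shadow (hT : T.IsTree) {u v b : V} (h : u ∉ shadow T v b) :
    shadow T u b = shadow T v b := by
  ext z
  constructor
  · intro hz
    exact (mem_shadow_or_mem_shadow hT hz v).resolve_left fun h' => h (mem_shadow_comm.1 h')
  · intro hz
    exact (mem_shadow_or_mem_shadow hT hz u).resolve_left h

theorem notMem_shadow_of_dist_lt {u v b : V} (h : T.dist v u < T.dist v b) :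
    u ∉ shadow T v b := by
  rw [mem_shadow]; omega

/-- A geodesic has at most one point at a given distance from its origin. -/
theorem eq_of_mem_shadow (hT : T.IsTree) {v b c z : V} (hb : z ∈ shadow T v b)
    (hc : z ∈ shadow T v c) (h : T.dist v b = T.dist v c) : b = c := by
  rcases mem_shadow_or_mem_shadow hT hb c with h1 | h1 <;> rw [mem_shadow] at *
  · exact hT.connected.dist_eq_zero_iff.1 (by omega)
  · exact (hT.connected.dist_eq_zero_iff.1 (by omega : T.dist c b = 0)).symm

theorem exists_dist_eq_of_le (hT : T.IsTree) (v : V) :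
    ∀ (z : V) (m : ℕ), m ≤ T.dist v z → ∃ b, T.dist v b = m ∧ z ∈ shadow T v b := by
  suffices H : ∀ k z m, T.dist v z = m + k → ∃ b, T.dist v b = m ∧ z ∈ shadow T v b from
    fun z m h => H (T.dist v z - m) z m (by omega)
  intro k
  induction k with
  | zero => exact fun z m h => ⟨z, h, self_mem_shadow _ _⟩
  | succ k ih =>
    intro z m h
    have hne : v ≠ z := by rintro rfl; simp at h
    obtain ⟨a, ha, hda⟩ := exists_adj_toward hT hne
    obtain ⟨b, hb, hab⟩ := ih a m (by omega)
    refine ⟨b, hb, shadow_subset_shadow hT hab ?_⟩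
    rw [mem_shadow, SimpleGraph.dist_eq_one_iff_adj.2 ha.symm, hda]

theorem mem_shadow_of_adj {v x y : V} (h : T.Adj x y) (hd : T.dist v y = T.dist v x + 1) :
    y ∈ shadow T v x := by
  rw [mem_shadow, SimpleGraph.dist_eq_one_iff_adj.2 h, hd]

theorem exists_child_of_mem_shadow (hT : T.IsTree) {v x z : V} (hz : z ∈ shadow T v x)
    (hne : z ≠ x) : ∃ y, T.Adj x y ∧ T.dist v y = T.dist v x + 1 ∧ z ∈ shadow T v y := by
  have hpos := hT.connected.pos_dist_of_ne hne.symm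
  obtain ⟨y, hy, hzy⟩ := exists_dist_eq_of_le hT x z 1 hpos
  have hxy := SimpleGraph.dist_eq_one_iff_adj.1 hy
  have h1 := hT.connected.dist_triangle (u := v) (v := y) (w := z)
  have h2 := hT.dist_eq_dist_add_one_of_adj v hxy
  rw [mem_shadow] at *
  exact ⟨y, hxy, by omega, by rw [mem_shadow]; omega⟩

/-! ### Rays in trees -/

/-- A sequence of children `x₀, x₁, …` of a root, as a ray. -/
def rayOfDist (v : V) (x : ℕ → V) (hadj : ∀ n, T.Adj (x n) (x (n + 1)))
    (hd : ∀ n, T.dist v (x n) = n) : Ray T :=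
  ⟨x, hadj, fun m n h => by rw [← hd m, ← hd n, h]⟩

theorem Ray.dist_eq (hT : T.IsTree) (r : Ray T) (n : ℕ) :
    T.dist (r.vertex 0) (r.vertex n) = n := by
  suffices H : T.dist (r.vertex 0) (r.vertex n) = n ∧
      T.dist (r.vertex 0) (r.vertex (n + 1)) = n + 1 from H.1
  induction n with
  | zero => exact ⟨by simp, by simpa using SimpleGraph.dist_eq_one_iff_adj.2 (r.adj 0)⟩
  | succ n ih =>
    refine ⟨ih.2, ?_⟩
    rcases hT.dist_eq_dist_add_one_of_adj (r.vertex 0) (r.adj (n + 1)) with h | h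
    · have := eq_of_adj_toward hT (r.adj n).symm (r.adj (n + 1)) (by omega) h
      exact absurd (r.injective this) (by omega)
    · omega

theorem Ray.mem_shadow (hT : T.IsTree) (r : Ray T) (k n : ℕ) :
    r.vertex (k + n) ∈ shadow T (r.vertex 0) (r.vertex k) := by
  have h1 := r.dist_eq hT (k + n)
  have h2 := r.dist_eq hT k
  have h3 : T.dist (r.vertex k) (r.vertex (k + n)) ≤ n := by
    clear h1 h2
    induction n with
    | zero => simp
    | succ n ih =>
      have := (hT.connected.dist_triangle (u := r.vertex k) (v := r.vertex (k + n))
        (w := r.vertex (k + n + 1)))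
      rw [SimpleGraph.dist_eq_one_iff_adj.2 (r.adj (k + n))] at this
      exact this.trans (by omega)
  have h4 := hT.connected.dist_triangle (u := r.vertex 0) (v := r.vertex k)
    (w := r.vertex (k + n))
  rw [TreeRep.mem_shadow]
  omega

/-- A property of vertices that holds at the root and passes to some child holds along some
ray. -/
theorem exists_ray_of_step (v : V) (Q : V → Prop) (hv : Q v)
    (hstep : ∀ x, Q x → ∃ y, T.Adj x y ∧ T.dist v y = T.dist v x + 1 ∧ Q y) :
    ∃ r : Ray T, r.vertex 0 = v ∧ ∀ n, Q (r.vertex n) := by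
  choose! f hf1 hf2 hf3 using hstep
  let x : ℕ → V := fun n => f^[n] v
  have hx : ∀ n, x (n + 1) = f (x n) := fun n => Function.iterate_succ_apply' f n v
  have hQ : ∀ n, Q (x n) := by
    intro n
    induction n with
    | zero => exact hv
    | succ n ih => rw [hx]; exact hf3 _ ih
  refine ⟨rayOfDist v x (fun n => hx n ▸ hf1 _ (hQ n)) ?_, rfl, hQ⟩
  intro n
  induction n with
  | zero => simp [x]
  | succ n ih => rw [hx, hf2 _ (hQ n), ih]

/-- König's lemma: an infinite set of vertices of a locally finite tree accumulates at an end. -/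
theorem exists_ray_of_infinite (hT : T.IsTree) (hfin : ∀ x, (T.neighborSet x).Finite) (v : V)
    {A : Set V} (hA : A.Infinite) :
    ∃ r : Ray T, r.vertex 0 = v ∧ ∀ n, (shadow T v (r.vertex n) ∩ A).Infinite := by
  refine exists_ray_of_step v (fun x => (shadow T v x ∩ A).Infinite) ?_ ?_
  · exact hA.mono fun z hz => ⟨mem_shadow_self _ _, hz⟩
  · intro x hx
    by_contra! hcon
    refine hx (Set.Finite.subset (((hfin x).subset
      (Set.sep_subset _ fun y => T.dist v y = T.dist v x + 1)).biUnion (t := fun y =>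
        shadow T v y ∩ A) ?_ |>.union (Set.finite_singleton x)) ?_)
    · exact fun y hy => hcon y hy.1 hy.2
    · rintro z ⟨hz, hzA⟩
      by_cases hzx : z = x
      · exact Or.inr hzx
      · obtain ⟨y, hy, hd, hzy⟩ := exists_child_of_mem_shadow hT hz hzx
        exact Or.inl (Set.mem_biUnion (x := y) ⟨hy, hd⟩ ⟨hzy, hzA⟩)

theorem finite_closedBall (hT : T.IsTree) (hfin : ∀ x, (T.neighborSet x).Finite) (v : V) (n : ℕ) :
    (closedBall T v n).Finite := by
  induction n with
  | zero =>
    refine (Set.finite_singleton v).subset fun x hx => ?_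
    exact (hT.connected.dist_eq_zero_iff.1 (Nat.le_zero.1 hx)).symm
  | succ n ih =>
    refine ((ih.biUnion fun x _ => hfin x).union (Set.finite_singleton v)).subset fun x hx => ?_
    by_cases hxv : v = x
    · exact Or.inr hxv.symm
    · obtain ⟨a, ha, hd⟩ := exists_adj_toward hT hxv
      change T.dist v x ≤ n + 1 at hx
      exact Or.inl (Set.mem_biUnion (x := a) (show T.dist v a ≤ n by omega) ha.symm)

theorem countable_of_locallyFinite (hT : T.IsTree) (hfin : ∀ x, (T.neighborSet x).Finite)
    (v : V) : Countable V := by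
  rw [← Set.countable_univ_iff]
  refine (Set.countable_iUnion fun n => (finite_closedBall hT hfin v n).countable).mono
    fun x _ => Set.mem_iUnion.2 ⟨T.dist v x, ?_⟩
  exact le_refl (T.dist v x)

theorem exists_le_dist_of_infinite (hT : T.IsTree) (hfin : ∀ x, (T.neighborSet x).Finite) (v : V)
    {A : Set V} (hA : A.Infinite) (n : ℕ) : ∃ x ∈ A, n ≤ T.dist v x := by
  by_contra! h
  exact hA ((finite_closedBall hT hfin v n).subset fun x hx => (h x hx).le)

/-- Three directions at each vertex: there is always one avoiding two given ones. -/
theorem exists_adj_ne_ne (h3 : ∀ x, 3 ≤ (T.neighborSet x).encard) (x a b : V) :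
    ∃ c, T.Adj x c ∧ c ≠ a ∧ c ≠ b := by
  by_contra! h
  have hsub : T.neighborSet x ⊆ {a, b} := by
    intro c hc
    by_cases hca : c = a
    · exact Or.inl hca
    · exact Or.inr (h c hc hca)
  have := (h3 x).trans ((Set.encard_le_encard hsub).trans ((Set.encard_insert_le {b} a).trans
    (by rw [Set.encard_singleton])))
  exact absurd this (by decide)

theorem exists_child (hT : T.IsTree) (h3 : ∀ x, 3 ≤ (T.neighborSet x).encard) (v x : V) :
    ∃ y, T.Adj x y ∧ T.dist v y = T.dist v x + 1 := by
  by_cases hx : v = x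
  · subst hx
    obtain ⟨y, hy, -⟩ := exists_adj_ne_ne h3 v v v
    exact ⟨y, hy, by simpa using SimpleGraph.dist_eq_one_iff_adj.2 hy⟩
  · obtain ⟨a, ha, hd⟩ := exists_adj_toward hT hx
    obtain ⟨y, hy, hya, -⟩ := exists_adj_ne_ne h3 x a a
    refine ⟨y, hy, ?_⟩
    rcases hT.dist_eq_dist_add_one_of_adj v hy with h | h
    · exact absurd (eq_of_adj_toward hT hy ha h hd) hya
    · exact h

end Tree

/-! ### Boundary-transitive groups of automorphisms -/

section Group

variable {V : Type u} {T : SimpleGraph V} {G : Subgroup (T ≃g T)}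

theorem smul_adj_iff (g : G) {x y : V} : T.Adj (g • x) (g • y) ↔ T.Adj x y :=
  g.1.map_rel_iff

theorem dist_smul (hT : T.IsTree) (g : G) (x y : V) : T.dist (g • x) (g • y) = T.dist x y := by
  have key : ∀ (g : G) (x y : V), T.dist (g • x) (g • y) ≤ T.dist x y := by
    intro g x y
    obtain ⟨p, hp⟩ := hT.connected.exists_walk_length_eq_dist x y
    have := T.dist_le (p.map g.1.toHom)
    rwa [SimpleGraph.Walk.length_map, hp] at this
  refine le_antisymm (key g x y) ?_
  simpa using key g⁻¹ (g • x) (g • y)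

theorem smul_mem_shadow_iff (hT : T.IsTree) (g : G) {v b z : V} :
    g • z ∈ shadow T (g • v) (g • b) ↔ z ∈ shadow T v b := by
  simp only [mem_shadow, dist_smul hT]

theorem exists_mem_shadow_dist (hT : T.IsTree) (h3 : ∀ x, 3 ≤ (T.neighborSet x).encard) (v x : V)
    (n : ℕ) : ∃ b ∈ shadow T v x, T.dist v b = T.dist v x + n := by
  induction n with
  | zero => exact ⟨x, self_mem_shadow _ _, rfl⟩
  | succ n ih =>
    obtain ⟨b, hb, hd⟩ := ih
    obtain ⟨y, hy, hdy⟩ := exists_child hT h3 v b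
    exact ⟨y, shadow_subset_shadow hT hb (mem_shadow_of_adj hy hdy), by omega⟩

/-- A Baire category argument: the boundary is a countable union of translates of the closure of
the `L`-orbit of `ξ`. Hence this closure has non-empty interior and, `L` being transitive on a dense
part of it, is a neighbourhood of `ξ`. -/
theorem exists_shadow_subset_orbit (hT : T.IsTree) (hfin : ∀ x, (T.neighborSet x).Finite)
    (h3 : ∀ x, 3 ≤ (T.neighborSet x).encard) (hG : MulAction.IsPretransitive G (Boundary T))
    (L : Subgroup G) [Countable (G ⧸ L)] {v : V} (hL : L ≤ MulAction.stabilizer G v) (ξ : Ray T)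
    (hξ : ξ.vertex 0 = v) :
    ∃ k, ∀ y ∈ shadow T v (ξ.vertex k), ∃ h ∈ L, ∃ n, h • ξ.vertex n = y := by
  by_contra! hcon
  have hLv : ∀ h ∈ L, h • v = v := fun h hh => hL hh
  have hdist : ∀ h ∈ L, ∀ n, T.dist v (h • ξ.vertex n) = n := by
    intro h hh n
    conv_lhs => rw [← hLv h hh, dist_smul hT, ← hξ, ξ.dist_eq hT]
  -- `X` is the union of the rays in the `L`-orbit of `ξ`; a ray from `v` lies in the closure of
  -- the orbit when its vertices lie in `X`.
  let X : Set V := {x | ∃ h ∈ L, ∃ n, h • ξ.vertex n = x}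
  -- No shadow along `ξ` is covered by `X`, so the closure of the `L`-orbit of `ξ` has empty
  -- interior.
  have hnowhere : ∀ b, ∃ b' ∈ shadow T v b, ∀ z ∈ shadow T v b', z ∉ X := by
    intro b
    obtain ⟨b', hb', hbX⟩ : ∃ b' ∈ shadow T v b, b' ∉ X := by
      by_cases hb : b ∈ X
      · obtain ⟨h, hh, n, rfl⟩ := hb
        obtain ⟨y, hy, hyX⟩ := hcon n
        refine ⟨h • y, ?_, ?_⟩
        · rw [← smul_mem_shadow_iff hT h, hLv h hh] at hy
          exact hy
        · rintro ⟨h', hh', m, he⟩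
          refine hyX (h⁻¹ * h') (L.mul_mem (L.inv_mem hh) hh') m ?_
          rw [mul_smul, he, inv_smul_smul]
      · exact ⟨b, self_mem_shadow _ _, hb⟩
    refine ⟨b', hb', ?_⟩
    rintro _ hz ⟨h, hh, m, rfl⟩
    have hd := hdist h hh m
    obtain ⟨i, hi⟩ : ∃ i, m = T.dist v b' + i :=
      ⟨T.dist b' (h • ξ.vertex m), by conv_lhs => rw [← hd, mem_shadow.1 hz]⟩
    have h1 := ξ.mem_shadow hT (T.dist v b') i
    rw [← smul_mem_shadow_iff hT h, hξ, hLv h hh, ← hi] at h1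
    exact hbX ⟨h, hh, _, eq_of_mem_shadow hT h1 hz (hdist h hh _)⟩
  -- The same for the translate of the orbit by `g`. Far enough away from `g • v`, shadows seen
  -- from `v` and from `g • v` agree.
  have htranslate : ∀ (g : G) (x : V), ∃ x' ∈ shadow T v x, T.dist v x < T.dist v x' ∧
      ∀ z ∈ shadow T v x', g⁻¹ • z ∉ X := by
    intro g x
    obtain ⟨b, hb, hdb⟩ := exists_mem_shadow_dist hT h3 v x (T.dist v (g • v) + 1)
    have hu : g • v ∉ shadow T v b := notMem_shadow_of_dist_lt (by omega)
    obtain ⟨c, hc, hcX⟩ := hnowhere (g⁻¹ • b)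
    have hx' : g • c ∈ shadow T v b := by
      rw [← smul_mem_shadow_iff hT g, smul_inv_smul, shadow_eq_shadow hT hu] at hc
      exact hc
    refine ⟨g • c, shadow_subset_shadow hT hb hx', ?_, ?_⟩
    · rw [mem_shadow] at hx'
      omega
    · intro z hz
      rw [← shadow_eq_shadow hT fun h => hu (shadow_subset_shadow hT hx' h)] at hz
      refine hcX _ ?_
      rwa [← smul_mem_shadow_iff hT g, smul_inv_smul]
  -- Enumerate the cosets of `L` and avoid their translates of `X` one after the other.
  obtain ⟨q, hq⟩ := exists_surjective_nat (G ⧸ L)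
  let gs : ℕ → G := fun i => (q i).out
  choose f hf1 hf2 hf3 using htranslate
  let x : ℕ → V := fun n => Nat.rec v (fun i y => f (gs i) y) n
  have hx : ∀ i, x (i + 1) = f (gs i) (x i) := fun i => rfl
  have hmono : StrictMono fun i => T.dist v (x i) :=
    strictMono_nat_of_lt_succ fun i => by rw [hx]; exact hf2 _ _
  have hnest : ∀ i j, i ≤ j → x j ∈ shadow T v (x i) := by
    intro i j hij
    induction j, hij using Nat.le_induction with
    | base => exact self_mem_shadow _ _
    | succ j _ ih => exact shadow_subset_shadow hT ih (by rw [hx]; exact hf1 _ _)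
  have hinf : (Set.range x).Infinite :=
    Set.infinite_range_of_injective (Function.Injective.of_comp (f := T.dist v) hmono.injective)
  obtain ⟨r, hr0, hr⟩ := exists_ray_of_infinite hT hfin v hinf
  have hrx : ∀ i, r.vertex (T.dist v (x i)) = x i := by
    intro i
    obtain ⟨_, ⟨hz, j, rfl⟩, hle⟩ :=
      exists_le_dist_of_infinite hT hfin v (hr (T.dist v (x i))) (T.dist v (x i))
    refine eq_of_mem_shadow hT hz (hnest i j (hmono.le_iff_le.1 hle)) ?_
    conv_lhs => rw [← hr0, r.dist_eq hT]
    rw [hr0]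
  -- The ray `r` lies in none of the translates, although `G` moves `ξ` to it.
  obtain ⟨g, hg⟩ := hG.exists_smul_eq (Quotient.mk (raySetoid T) ξ) (Quotient.mk (raySetoid T) r)
  obtain ⟨a, b, hab⟩ : Ray.Cofinal (Ray.map g.1 ξ) r := Quotient.exact hg
  obtain ⟨i, hi⟩ := hq (g : G ⧸ L)
  have hmem : (gs i)⁻¹ * g ∈ L := by
    rw [← QuotientGroup.eq, ← hi]
    exact Quotient.out_eq' _
  set m := T.dist v (x (i + 1)) with hm
  have hshadow : r.vertex (b + m) ∈ shadow T v (x (i + 1)) := by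
    have := r.mem_shadow hT m b
    rwa [hr0, add_comm, hm, hrx (i + 1)] at this
  refine hf3 (gs i) (x i) _ hshadow ⟨_, hmem, a + m, ?_⟩
  rw [mul_smul, ← hab m]
  rfl

/-- Beyond some level, all vertices of equal level behind a common vertex are conjugate under
`L`: the number of `L`-orbits on spheres stabilizes. Otherwise the vertices for which this fails
would accumulate at an end, against `exists_shadow_subset_orbit`. -/
theorem exists_level_conjugate (hT : T.IsTree) (hfin : ∀ x, (T.neighborSet x).Finite)
    (h3 : ∀ x, 3 ≤ (T.neighborSet x).encard) (hG : MulAction.IsPretransitive G (Boundary T))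
    (L : Subgroup G) [Countable (G ⧸ L)] {v : V} (hL : L ≤ MulAction.stabilizer G v) :
    ∃ M, ∀ y, M ≤ T.dist v y → ∀ z ∈ shadow T v y, ∀ z' ∈ shadow T v y,
      T.dist v z = T.dist v z' → ∃ h ∈ L, h • z = z' := by
  by_contra! hcon
  let A : Set V := {y | ∃ z ∈ shadow T v y, ∃ z' ∈ shadow T v y,
      T.dist v z = T.dist v z' ∧ ∀ h ∈ L, h • z ≠ z'}
  have hA : A.Infinite := by
    intro hA
    obtain ⟨M, hM⟩ := (hA.image (T.dist v)).bddAbove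
    obtain ⟨y, hy, hyA⟩ := hcon (M + 1)
    have := hM (Set.mem_image_of_mem (T.dist v) (show y ∈ A from hyA))
    omega
  obtain ⟨r, hr0, hr⟩ := exists_ray_of_infinite hT hfin v hA
  obtain ⟨k, hk⟩ := exists_shadow_subset_orbit hT hfin h3 hG L hL r hr0
  obtain ⟨y, hy, z, hz, z', hz', hd, hne⟩ := (hr k).nonempty
  obtain ⟨h, hh, n, rfl⟩ := hk z (shadow_subset_shadow hT hy hz)
  obtain ⟨h', hh', n', rfl⟩ := hk z' (shadow_subset_shadow hT hy hz')
  have hdist : ∀ h ∈ L, ∀ n, T.dist v (h • r.vertex n) = n := by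
    intro h hh n
    have hv : h • v = v := hL hh
    conv_lhs => rw [← hv, dist_smul hT, ← hr0, r.dist_eq hT]
  rw [hdist h hh, hdist h' hh'] at hd
  subst hd
  refine hne (h' * h⁻¹) (L.mul_mem hh' (L.inv_mem hh)) ?_
  rw [mul_smul, inv_smul_smul]

theorem countable_quotient_fixingSubgroup [Countable V] {B : Set V} (hB : B.Finite) :
    Countable (G ⧸ fixingSubgroup G B) := by
  have := hB.to_subtype
  refine Function.Injective.countable (β := B → V)
    (f := fun q : G ⧸ fixingSubgroup G B => fun x : B => q.out • (x : V)) fun q q' h => ?_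
  rw [← Quotient.out_eq' q, ← Quotient.out_eq' q', QuotientGroup.eq, mem_fixingSubgroup_iff]
  intro x hx
  have hqx : q.out • x = q'.out • x := congrFun h ⟨x, hx⟩
  rw [mul_smul, ← hqx, inv_smul_smul]

theorem countable_quotient_stabilizer [Countable V] (v : V) :
    Countable (G ⧸ MulAction.stabilizer G v) :=
  (MulAction.orbitEquivQuotientStabilizer G v).symm.injective.countable

/-- A closed group of automorphisms with a finite orbit is compact: all its orbits are finite, so an
ultrafilter on the group converges pointwise, together with the inverses, to an automorphism. -/
theorem infinite_orbit (hT : T.IsTree) (hfin : ∀ x, (T.neighborSet x).Finite)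
    (hclosed : IsClosed (G : Set (T ≃g T))) (hnoncompact : ¬ IsCompact (G : Set (T ≃g T)))
    (v : V) : (MulAction.orbit G v).Infinite := by
  intro hv
  refine hnoncompact (isCompact_iff_ultrafilter_le_nhds.2 fun U hU => ?_)
  have hUG : ∀ᶠ g in (U : Filter (T ≃g T)), g ∈ G := Filter.le_principal_iff.1 hU
  have horb : ∀ x : V, {y | ∃ g ∈ G, g x = y}.Finite := by
    intro x
    refine (hv.biUnion fun y _ => finite_closedBall hT hfin y (T.dist v x)).subset ?_
    rintro _ ⟨g, hg, rfl⟩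
    refine Set.mem_biUnion (x := (⟨g, hg⟩ : G) • v) (MulAction.mem_orbit _ _) ?_
    exact (dist_smul hT (⟨g, hg⟩ : G) v x).le
  have hlim : ∀ F : (T ≃g T) → (T ≃g T), (∀ g ∈ G, F g ∈ G) → ∀ x, ∃ y,
      ∀ᶠ g in (U : Filter (T ≃g T)), F g x = y := by
    intro F hF x
    have : (⋃ y ∈ {y | ∃ g ∈ G, g x = y}, {g : T ≃g T | F g x = y}) ∈ U := by
      filter_upwards [hUG] with g hg
      exact Set.mem_biUnion (x := F g x) ⟨F g, hF g hg, rfl⟩ rfl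
    obtain ⟨y, -, hy⟩ := (Ultrafilter.finite_biUnion_mem_iff (horb x)).1 this
    exact ⟨y, hy⟩
  choose φ hφ using hlim id fun g hg => hg
  choose ψ hψ using hlim (fun g => g⁻¹) fun g hg => G.inv_mem hg
  let Φ : T ≃g T :=
    { toFun := φ
      invFun := ψ
      left_inv := fun x => by
        obtain ⟨g, h1, h2⟩ := ((hφ x).and (hψ (φ x))).exists
        rw [← h2, ← h1]
        exact g.symm_apply_apply x
      right_inv := fun x => by
        obtain ⟨g, h1, h2⟩ := ((hψ x).and (hφ (ψ x))).exists
        rw [← h2, ← h1]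
        exact g.apply_symm_apply x
      map_rel_iff' := by
        intro x y
        obtain ⟨g, h1, h2⟩ := ((hφ x).and (hφ y)).exists
        change T.Adj (φ x) (φ y) ↔ _
        rw [← h1, ← h2]
        exact g.map_rel_iff }
  have hle : (U : Filter (T ≃g T)) ≤ nhds Φ := by
    let _ : TopologicalSpace V := ⊥
    have : DiscreteTopology V := ⟨rfl⟩
    rw [nhds_induced, ← Filter.tendsto_iff_comap, tendsto_pi_nhds]
    intro x
    rw [nhds_discrete, Filter.tendsto_pure]
    exact hφ x
  exact ⟨Φ, isClosed_iff_ultrafilter.1 hclosed Φ U hle (Filter.le_principal_iff.1 hU), hle⟩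

/-- Every orbit goes to infinity in every direction: some end is a limit of the orbit, hence, by
transitivity, every end is. -/
theorem infinite_shadow_inter_orbit (hT : T.IsTree) (hfin : ∀ x, (T.neighborSet x).Finite)
    (h3 : ∀ x, 3 ≤ (T.neighborSet x).encard) (hG : MulAction.IsPretransitive G (Boundary T))
    {v : V} (hv : (MulAction.orbit G v).Infinite) {y z : V} (hyz : T.Adj y z) :
    (shadow T y z ∩ MulAction.orbit G v).Infinite := by
  obtain ⟨r, hr0, hr⟩ := exists_ray_of_infinite hT hfin v hv
  obtain ⟨s, hs0, hs⟩ := exists_ray_of_step (T := T) y (fun x => x = y ∨ x ∈ shadow T y z)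
    (Or.inl rfl) (by
      rintro x (rfl | hx)
      · exact ⟨z, hyz, by simpa using SimpleGraph.dist_eq_one_iff_adj.2 hyz,
          Or.inr (self_mem_shadow _ _)⟩
      · obtain ⟨c, hc, hd⟩ := exists_child hT h3 y x
        exact ⟨c, hc, hd, Or.inr (shadow_subset_shadow hT hx (mem_shadow_of_adj hc hd))⟩)
  obtain ⟨g, hg⟩ := hG.exists_smul_eq (Quotient.mk (raySetoid T) r) (Quotient.mk (raySetoid T) s)
  obtain ⟨a, b, hab⟩ : Ray.Cofinal (Ray.map g.1 r) s := Quotient.exact hg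
  set n := T.dist (g • v) y + 1 with hn
  have hgn : g • r.vertex (a + n) = s.vertex (b + n) := hab n
  have hsz : s.vertex (b + n) ∈ shadow T y z := by
    refine (hs (b + n)).resolve_left fun h => ?_
    rw [← hs0] at h
    exact absurd (s.injective h) (by omega)
  have hy : y ∉ shadow T (g • v) (s.vertex (b + n)) := by
    refine notMem_shadow_of_dist_lt ?_
    rw [← hgn, dist_smul hT, ← hr0, r.dist_eq hT, hr0]
    omega
  refine ((hr (a + n)).image (MulAction.injective g).injOn).mono ?_
  rintro _ ⟨x, ⟨hx, hxv⟩, rfl⟩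
  refine ⟨shadow_subset_shadow hT hsz ?_, ?_⟩
  · rw [shadow_eq_shadow hT hy, ← hgn]
    exact (smul_mem_shadow_iff hT g).2 hx
  · obtain ⟨k, rfl⟩ := hxv
    exact ⟨g * k, mul_smul _ _ _⟩

/-- Vertex stabilizers are transitive on spheres. Any two points `a`, `b` of a sphere around `y`
are seen behind `y` from some point of a given orbit far away in a third direction, and the
stabilizer of such a point conjugates them. -/
theorem exists_mem_stabilizer_smul_eq (hT : T.IsTree) (hfin : ∀ x, (T.neighborSet x).Finite)
    (h3 : ∀ x, 3 ≤ (T.neighborSet x).encard) (hG : MulAction.IsPretransitive G (Boundary T))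
    (hclosed : IsClosed (G : Set (T ≃g T))) (hnoncompact : ¬ IsCompact (G : Set (T ≃g T)))
    {y a b : V} (hab : T.dist y a = T.dist y b) :
    ∃ g ∈ MulAction.stabilizer G y, g • a = b := by
  by_cases hya : a = y
  · subst hya
    refine ⟨1, Subgroup.one_mem _, ?_⟩
    rw [one_smul]
    exact hT.connected.dist_eq_zero_iff.1 (by rw [← hab, SimpleGraph.dist_self])
  have hyb : b ≠ y := by
    rintro rfl
    rw [SimpleGraph.dist_self] at hab
    exact hya (hT.connected.dist_eq_zero_iff.1 hab).symm
  have := countable_of_locallyFinite hT hfin y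
  have := countable_quotient_stabilizer (G := G) y
  obtain ⟨M, hM⟩ := exists_level_conjugate hT hfin h3 hG (MulAction.stabilizer G y) le_rfl
  obtain ⟨a', ha', hda⟩ := exists_adj_toward hT hya
  obtain ⟨b', hb', hdb⟩ := exists_adj_toward hT hyb
  obtain ⟨c, hc, hca, hcb⟩ := exists_adj_ne_ne h3 y a' b'
  obtain ⟨_, ⟨hx, g, rfl⟩, hle⟩ := exists_le_dist_of_infinite hT hfin y
    (infinite_shadow_inter_orbit hT hfin h3 hG (infinite_orbit hT hfin hclosed hnoncompact y) hc) M
  set x := g • y with hxdef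
  have hdx : T.dist x y = T.dist x c + 1 := by
    rw [mem_shadow, SimpleGraph.dist_eq_one_iff_adj.2 hc] at hx
    rw [T.dist_comm (u := x), T.dist_comm (u := x) (v := c)]
    change T.dist y x = 1 + T.dist c x at hx
    omega
  have hax := mem_shadow_of_adj_ne hT hc ha' hca hdx hda
  have hbx := mem_shadow_of_adj_ne hT hc hb' hcb hdx hdb
  have hback : ∀ {p q : V}, p ∈ shadow T x q → g⁻¹ • p ∈ shadow T y (g⁻¹ • q) := by
    intro p q h
    rwa [← smul_mem_shadow_iff hT g⁻¹, hxdef, inv_smul_smul] at h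
  have hbackd : ∀ p, T.dist y (g⁻¹ • p) = T.dist x p := by
    intro p
    rw [← dist_smul hT g, smul_inv_smul]
  obtain ⟨h, hh, hhab⟩ := hM (g⁻¹ • y) (by rw [hbackd, T.dist_comm]; exact hle) (g⁻¹ • a)
    (hback hax) (g⁻¹ • b) (hback hbx) (by
      rw [hbackd, hbackd, mem_shadow.1 hax, mem_shadow.1 hbx, hab])
  have hk : (g * h * g⁻¹) • a = b := by
    rw [mul_smul, mul_smul, hhab, smul_inv_smul]
  have hkx : (g * h * g⁻¹) • x = x := by
    rw [mul_smul, mul_smul, hxdef, inv_smul_smul, MulAction.mem_stabilizer_iff.1 hh]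
  refine ⟨g * h * g⁻¹, ?_, hk⟩
  have h1 := (smul_mem_shadow_iff hT (g * h * g⁻¹)).2 hax
  rw [hk, hkx] at h1
  refine eq_of_mem_shadow hT h1 hbx ?_
  conv_lhs => rw [← hkx, dist_smul hT]

/-- The vertices at even distance from `v` lie in the orbit of `v`, because two neighbours of a
vertex are conjugate; so no edge has both ends outside of the orbit. -/
theorem mem_orbit_of_adj (hT : T.IsTree)
    (hS : ∀ y a b : V, T.dist y a = T.dist y b → ∃ g ∈ MulAction.stabilizer G y, g • a = b)
    {v x y : V} (hx : x ∉ MulAction.orbit G v) (hxy : T.Adj x y) : y ∈ MulAction.orbit G v := by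
  have key : ∀ n z, T.dist v z = n + n → z ∈ MulAction.orbit G v := by
    intro n
    induction n with
    | zero =>
      intro z hz
      rw [← hT.connected.dist_eq_zero_iff.1 hz]
      exact MulAction.mem_orbit_self v
    | succ n ih =>
      intro z hz
      have hvz : v ≠ z := by rintro rfl; simp at hz
      obtain ⟨a, ha, hda⟩ := exists_adj_toward hT hvz
      have hva : v ≠ a := by rintro rfl; rw [SimpleGraph.dist_self] at hda; omega
      obtain ⟨b, hb, hdb⟩ := exists_adj_toward hT hva
      obtain ⟨g, -, rfl⟩ := hS a b z (by
        rw [SimpleGraph.dist_eq_one_iff_adj.2 hb, SimpleGraph.dist_eq_one_iff_adj.2 ha.symm])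
      obtain ⟨k, rfl⟩ := ih b (by omega)
      exact ⟨g * k, mul_smul _ _ _⟩
  rcases Nat.even_or_odd (T.dist v y) with ⟨n, hn⟩ | ⟨n, hn⟩
  · exact key n y hn
  · rcases hT.dist_eq_dist_add_one_of_adj v hxy with h | h
    · exact absurd (key (n + 1) x (by omega)) hx
    · exact absurd (key n x (by omega)) hx

/-- An eigenfunction on the tree that is invariant under `L` is determined by its values on a
ball: beyond level `M`, all children of a vertex carry the same value, so that the eigenvalue
equation yields it from the values at the vertex and its parent. -/
theorem mem_span_of_eigenfunction (hT : T.IsTree) (hfin : ∀ x, (T.neighborSet x).Finite)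
    (L : Subgroup G) {v : V} {M : ℕ}
    (hM : ∀ y, M ≤ T.dist v y → ∀ z ∈ shadow T v y, ∀ z' ∈ shadow T v y,
      T.dist v z = T.dist v z' → ∃ h ∈ L, h • z = z')
    {E : Type w} [AddCommGroup E] [Module ℂ E] (F : V → E) (c : V → ℂ)
    (hinv : ∀ h ∈ L, ∀ x, F (h • x) = F x)
    (heig : ∀ x, ∑ y ∈ (hfin x).toFinset, F y = c x • F x) (x : V) :
    F x ∈ Submodule.span ℂ (F '' closedBall T v (M + 1)) := by
  classical
  induction hd : T.dist v x using Nat.strong_induction_on generalizing x with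
  | _ n ih =>
  by_cases hn : n ≤ M + 1
  · exact Submodule.subset_span (Set.mem_image_of_mem F (show T.dist v x ≤ M + 1 by omega))
  have hvx : v ≠ x := by rintro rfl; rw [SimpleGraph.dist_self] at hd; omega
  obtain ⟨p, hp, hdp⟩ := exists_adj_toward hT hvx
  have hvp : v ≠ p := by rintro rfl; rw [SimpleGraph.dist_self] at hdp; omega
  obtain ⟨q, hq, hdq⟩ := exists_adj_toward hT hvp
  have hsame : ∀ y ∈ (hfin p).toFinset.erase q, F y = F x := by
    intro y hy
    obtain ⟨hyq, hy⟩ := Finset.mem_erase.1 hy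
    have hpy : T.Adj p y := by simpa using hy
    have hdy : T.dist v y = T.dist v p + 1 := by
      rcases hT.dist_eq_dist_add_one_of_adj v hpy with h | h
      · exact absurd (eq_of_adj_toward hT hpy hq h hdq) hyq
      · exact h
    obtain ⟨h, hh, rfl⟩ := hM p (by omega) y (mem_shadow_of_adj hpy hdy) x
      (mem_shadow_of_adj hp.symm hdp) (by omega)
    exact (hinv h hh y).symm
  have hxmem : x ∈ (hfin p).toFinset.erase q := by
    refine Finset.mem_erase.2 ⟨?_, by simpa using hp.symm⟩
    rintro rfl
    omega
  have hcard : (((hfin p).toFinset.erase q).card : ℂ) ≠ 0 :=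
    Nat.cast_ne_zero.2 (Finset.card_ne_zero_of_mem hxmem)
  have hsum := heig p
  rw [← Finset.add_sum_erase _ _ (show q ∈ (hfin p).toFinset by simpa using hq),
    Finset.sum_congr rfl hsame, Finset.sum_const, ← Nat.cast_smul_eq_nsmul ℂ] at hsum
  have hFx : F x = (((hfin p).toFinset.erase q).card : ℂ)⁻¹ • (c p • F p - F q) := by
    rw [eq_inv_smul_iff₀ hcard, ← hsum, add_sub_cancel_left]
  rw [hFx]
  exact Submodule.smul_mem _ _ (Submodule.sub_mem _
    (Submodule.smul_mem _ _ (ih _ (by omega) p rfl)) (ih _ (by omega) q rfl))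

end Group

/-! ### Gelfand pairs and spherical vectors -/

theorem smul_mem_orbit_iff {G X : Type*} [Group G] [MulAction G X] (g : G) {v x : X} :
    g • x ∈ MulAction.orbit G v ↔ x ∈ MulAction.orbit G v := by
  rw [MulAction.mem_orbit_symm, MulAction.orbit_smul, MulAction.mem_orbit_symm]

section Representation

variable {G : Type u} [Group G] [TopologicalSpace G] {H : Type w} [NormedAddCommGroup H]
  [InnerProductSpace ℂ H] [CompleteSpace H] (π : UnitaryRep G H)

/-- The operator on `H` by which `g` acts, as a continuous linear map. -/
noncomputable def UnitaryRep.op (g : G) : H →L[ℂ] H := (π.toHom g : H →L[ℂ] H)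

theorem UnitaryRep.op_mul_apply (g h : G) (x : H) : π.op (g * h) x = π.op g (π.op h x) := by
  simp [UnitaryRep.op]

theorem UnitaryRep.op_one_apply (x : H) : π.op 1 x = x := by
  simp [UnitaryRep.op]

theorem UnitaryRep.inner_op_left (g : G) (x y : H) :
    inner ℂ (π.op g x) y = inner ℂ x (π.op g⁻¹ y) := by
  have h := ContinuousLinearMap.inner_map_map_of_mem_unitary (π.toHom g).2 x (π.op g⁻¹ y)
  rw [← h]
  change _ = inner ℂ (π.op g x) (π.op g (π.op g⁻¹ y))
  rw [← π.op_mul_apply, mul_inv_cancel, π.op_one_apply]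

theorem UnitaryRep.mem_invariants {K : Subgroup G} {x : H} :
    x ∈ π.invariants K ↔ ∀ g ∈ K, π.op g x = x := Iff.rfl

theorem UnitaryRep.isClosed_invariants (K : Subgroup G) :
    IsClosed (π.invariants K : Set H) := by
  have : (π.invariants K : Set H) = ⋂ g ∈ K, {x | π.op g x = x} := by
    ext x
    simp only [Set.mem_iInter]
    rfl
  rw [this]
  exact isClosed_biInter fun g _ => isClosed_eq (π.op g).continuous continuous_id

instance UnitaryRep.completeSpace_invariants (K : Subgroup G) :
    CompleteSpace (π.invariants K) :=
  (π.isClosed_invariants K).completeSpace_coe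

/-- The orthogonal projection onto the `K`-invariant vectors. -/
noncomputable def UnitaryRep.proj (K : Subgroup G) : H →L[ℂ] π.invariants K :=
  (π.invariants K).orthogonalProjectionOnto

theorem UnitaryRep.inner_proj (K : Subgroup G) (x : H) (w : π.invariants K) :
    inner ℂ (π.proj K x) w = inner ℂ x (w : H) :=
  Submodule.inner_orthogonalProjectionOnto_eq_of_mem_right w x

theorem UnitaryRep.proj_coe (K : Subgroup G) (w : π.invariants K) : π.proj K w = w :=
  Submodule.orthogonalProjectionOnto_mem_subspace_eq_self w

theorem UnitaryRep.proj_op {K : Subgroup G} {k : G} (hk : k ∈ K) (x : H) :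
    π.proj K (π.op k x) = π.proj K x := by
  refine ext_inner_right ℂ fun w => ?_
  rw [π.inner_proj, π.inner_proj, π.inner_op_left,
    show π.op k⁻¹ w = w from w.2 _ (K.inv_mem hk)]

/-- In an irreducible representation every non-zero vector is cyclic. -/
theorem UnitaryRep.IsIrreducible.eq_top_of_isClosed {π : UnitaryRep G H} (hπ : π.IsIrreducible)
    {x : H} (hx : x ≠ 0) {W : Submodule ℂ H} (hW : IsClosed (W : Set H))
    (hxW : ∀ g, π.op g x ∈ W) : W = ⊤ := by
  let S : Submodule ℂ H := Submodule.span ℂ (Set.range fun g => π.op g x)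
  have hS : ∀ g, ∀ y ∈ S, π.op g y ∈ S := by
    intro g y hy
    induction hy using Submodule.span_induction with
    | mem y hy =>
      obtain ⟨h, rfl⟩ := hy
      exact Submodule.subset_span ⟨g * h, π.op_mul_apply g h x⟩
    | zero => rw [map_zero]; exact S.zero_mem
    | add y z _ _ hy hz => rw [map_add]; exact S.add_mem hy hz
    | smul c y _ hy => rw [map_smul]; exact S.smul_mem c hy
  have hxS : x ∈ S := Submodule.subset_span ⟨1, π.op_one_apply x⟩
  rcases hπ.2 S.topologicalClosure S.isClosed_topologicalClosure
    (fun g y hy => map_mem_closure (π.op g).continuous hy (hS g)) with h | h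
  · have : x ∈ S.topologicalClosure := S.le_topologicalClosure hxS
    rw [h, Submodule.mem_bot] at this
    exact absurd this hx
  · refine eq_top_iff.2 (h ▸ S.topologicalClosure_minimal (Submodule.span_le.2 ?_) hW)
    rintro _ ⟨g, rfl⟩
    exact hxW g

/-- The Hecke operator of the double coset of `g`: the compression of `π g` to the `K`-invariant
vectors. -/
noncomputable def UnitaryRep.hecke (K : Subgroup G) (g : G) :
    π.invariants K →L[ℂ] π.invariants K :=
  π.proj K ∘L π.op g ∘L (π.invariants K).subtypeL

theorem UnitaryRep.hecke_apply (K : Subgroup G) (g : G) (w : π.invariants K) :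
    π.hecke K g w = π.proj K (π.op g w) := rfl

theorem UnitaryRep.isSelfAdjoint_hecke {K : Subgroup G}
    (hK : ∀ g : G, ∃ k ∈ K, ∃ k' ∈ K, g⁻¹ = k * g * k') (g : G) :
    IsSelfAdjoint (π.hecke K g) := by
  rw [ContinuousLinearMap.isSelfAdjoint_iff_isSymmetric]
  intro w w'
  obtain ⟨k, hk, k', hk', h⟩ := hK g
  change inner ℂ (π.hecke K g w) w' = inner ℂ w (π.hecke K g w')
  rw [← inner_conj_symm w, π.hecke_apply, π.hecke_apply, π.inner_proj, π.inner_proj,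
    π.inner_op_left, h, π.op_mul_apply, π.op_mul_apply, 
    show π.op k' w' = w' from w'.2 k' hk', ← inv_inv k, ← π.inner_op_left,
    show π.op k⁻¹ w = w from w.2 _ (K.inv_mem hk), inner_conj_symm]

section Orbit

variable {X : Type*} [MulAction G X]

/-- For a vector `w` fixed by the stabilizer of `v`, the translate `π g w` only depends on the
point `x = g • v`; this is the resulting vector-valued function of `x`, extended by zero outside
of the orbit of `v`. -/
noncomputable def UnitaryRep.vectorAt (v : X) (w : H) (x : X) : H :=
  open Classical in if h : ∃ g : G, g • v = x then π.op h.choose w else 0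

theorem UnitaryRep.vectorAt_smul_base {v : X} {w : H}
    (hw : w ∈ π.invariants (MulAction.stabilizer G v)) (g : G) :
    π.vectorAt v w (g • v) = π.op g w := by
  have h : ∃ g' : G, g' • v = g • v := ⟨g, rfl⟩
  rw [UnitaryRep.vectorAt, dif_pos h]
  have hmem : g⁻¹ * h.choose ∈ MulAction.stabilizer G v := by
    rw [MulAction.mem_stabilizer_iff, mul_smul, h.choose_spec, inv_smul_smul]
  have := congrArg (π.op g) (hw _ hmem)
  change π.op g (π.op _ w) = _ at this
  rwa [← π.op_mul_apply, mul_inv_cancel_left] at this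

theorem UnitaryRep.vectorAt_smul {v : X} {w : H}
    (hw : w ∈ π.invariants (MulAction.stabilizer G v)) (g : G) (x : X) :
    π.vectorAt v w (g • x) = π.op g (π.vectorAt v w x) := by
  by_cases hx : ∃ h : G, h • v = x
  · obtain ⟨h, rfl⟩ := hx
    rw [← mul_smul, π.vectorAt_smul_base hw, π.vectorAt_smul_base hw, π.op_mul_apply]
  · have hgx : ¬ ∃ h : G, h • v = g • x := by
      rintro ⟨h, hh⟩
      exact hx ⟨g⁻¹ * h, by rw [mul_smul, hh, inv_smul_smul]⟩
    rw [UnitaryRep.vectorAt, UnitaryRep.vectorAt, dif_neg hx, dif_neg hgx, map_zero]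

/-- The sum of an equivariant function over a finite invariant set is invariant. -/
theorem UnitaryRep.sum_mem_invariants {K : Subgroup G} {f : X → H} {s : Finset X}
    (hs : ∀ k ∈ K, ∀ x, k • x ∈ s ↔ x ∈ s) (hf : ∀ k ∈ K, ∀ x, f (k • x) = π.op k (f x)) :
    ∑ x ∈ s, f x ∈ π.invariants K := by
  intro k hk
  change π.op k _ = _
  rw [map_sum]
  exact Finset.sum_equiv (MulAction.toPerm k) (fun x => (hs k hk x).symm)
    fun x _ => (hf k hk x).symm

/-- The projection of `π h w` to the `K`-invariant vectors is the average of `π t w` over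
representatives `t` of the finitely many points `t • v` of the `K`-orbit of `h • v`. Hence a
product of two Hecke operators is an average of Hecke operators. -/
theorem UnitaryRep.exists_card_smul_hecke_mul {v : X}
    (hfin : ∀ g : G, (MulAction.orbit (MulAction.stabilizer G v) (g • v)).Finite) (g h : G) :
    ∃ (s : Finset X) (t : X → G), s.Nonempty ∧
      (s.card : ℂ) • (π.hecke (MulAction.stabilizer G v) g * π.hecke (MulAction.stabilizer G v) h)
        = ∑ y ∈ s, π.hecke (MulAction.stabilizer G v) (g * t y) := by
  set K := MulAction.stabilizer G v with hKdef
  have hex : ∀ y : X, ∃ t : G, y ∈ MulAction.orbit K (h • v) →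
      t • v = y ∧ ∃ k ∈ K, t = k * h := by
    intro y
    by_cases hy : y ∈ MulAction.orbit K (h • v)
    · obtain ⟨k, rfl⟩ := hy
      exact ⟨k * h, fun _ => ⟨mul_smul _ _ _, k, k.2, rfl⟩⟩
    · exact ⟨1, fun hy' => absurd hy' hy⟩
  choose t ht using hex
  refine ⟨(hfin h).toFinset, t, ⟨h • v, by simp⟩, ?_⟩
  ext1 w
  have hsum : ∑ y ∈ (hfin h).toFinset, π.vectorAt v w y ∈ π.invariants K := by
    refine π.sum_mem_invariants (fun k hk x => ?_) fun k _ x => π.vectorAt_smul w.2 k x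
    rw [Set.Finite.mem_toFinset, Set.Finite.mem_toFinset]
    exact smul_mem_orbit_iff (⟨k, hk⟩ : K)
  have hvec : ∀ y ∈ (hfin h).toFinset, π.vectorAt v (w : H) y = π.op (t y) w := by
    intro y hy
    obtain ⟨h1, -⟩ := ht y (by simpa using hy)
    conv_lhs => rw [← h1, π.vectorAt_smul_base w.2]
  have hproj : ∀ y ∈ (hfin h).toFinset, π.proj K (π.op (t y) w) = π.hecke K h w := by
    intro y hy
    obtain ⟨-, k, hk, hkt⟩ := ht y (by simpa using hy)
    rw [hkt, π.op_mul_apply, π.proj_op hk, π.hecke_apply]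
  have havg : ((hfin h).toFinset.card : ℂ) • (π.hecke K h w : H)
      = ∑ y ∈ (hfin h).toFinset, π.op (t y) w := by
    have h1 : π.proj K (∑ y ∈ (hfin h).toFinset, π.op (t y) w)
        = ((hfin h).toFinset.card : ℂ) • π.hecke K h w := by
      rw [map_sum, Finset.sum_congr rfl hproj, Finset.sum_const, Nat.cast_smul_eq_nsmul]
    rw [Finset.sum_congr rfl hvec] at hsum
    have h2 := π.proj_coe K ⟨_, hsum⟩
    rw [h1] at h2
    exact congrArg Subtype.val h2
  have h3 : ((hfin h).toFinset.card : ℂ) • π.hecke K g (π.hecke K h w)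
      = ∑ y ∈ (hfin h).toFinset, π.hecke K (g * t y) w := by
    rw [π.hecke_apply K g, ← map_smul, ← map_smul, havg, map_sum, map_sum]
    exact Finset.sum_congr rfl fun y _ => by rw [π.hecke_apply, π.op_mul_apply]
  rw [sum_apply, ← h3]
  rfl

/-- Gelfand's trick: products of the self-adjoint Hecke operators are averages of Hecke
operators, hence self-adjoint, so the Hecke operators commute. -/
theorem UnitaryRep.commute_hecke {v : X}
    (hfin : ∀ g : G, (MulAction.orbit (MulAction.stabilizer G v) (g • v)).Finite)
    (hK : ∀ g : G, ∃ k ∈ MulAction.stabilizer G v, ∃ k' ∈ MulAction.stabilizer G v,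
      g⁻¹ = k * g * k') (g h : G) :
    Commute (π.hecke (MulAction.stabilizer G v) g) (π.hecke (MulAction.stabilizer G v) h) := by
  rw [(π.isSelfAdjoint_hecke hK g).commute_iff (π.isSelfAdjoint_hecke hK h)]
  obtain ⟨s, t, hs, hst⟩ := π.exists_card_smul_hecke_mul hfin g h
  have hcard : (s.card : ℂ) ≠ 0 := Nat.cast_ne_zero.2 (Finset.card_ne_zero.2 hs)
  rw [← eq_inv_smul_iff₀ hcard] at hst
  rw [hst]
  refine IsSelfAdjoint.smul (by simp [isSelfAdjoint_iff]) ?_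
  rw [ContinuousLinearMap.isSelfAdjoint_iff_isSymmetric, ContinuousLinearMap.toLinearMap_sum]
  exact LinearMap.isSymmetric_sum _ fun y _ => (π.isSelfAdjoint_hecke hK (g * t y)).isSymmetric

end Orbit

/-- Schur's lemma for the Hecke operators: the kernel of an operator commuting with them is trivial
or everything, since it contains, along with `w`, the projections of all translates of `w`. -/
theorem UnitaryRep.IsIrreducible.eq_zero_of_commute_hecke {π : UnitaryRep G H}
    (hπ : π.IsIrreducible) {K : Subgroup G} {S : π.invariants K →L[ℂ] π.invariants K}
    (hS : ∀ g, Commute S (π.hecke K g)) {w : π.invariants K} (hw : w ≠ 0) (hSw : S w = 0) :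
    S = 0 := by
  have h : (S ∘L π.proj K).ker = ⊤ := by
    refine hπ.eq_top_of_isClosed (x := w) (by simpa using hw)
      (ContinuousLinearMap.isClosed_ker _) fun g => ?_
    change S (π.hecke K g w) = 0
    have := congrArg (fun A : π.invariants K →L[ℂ] π.invariants K => A w) (hS g).eq
    change S (π.hecke K g w) = π.hecke K g (S w) at this
    rw [this, hSw, map_zero]
  ext1 e
  have he : (e : H) ∈ (S ∘L π.proj K).ker := h ▸ Submodule.mem_top
  change S (π.proj K e) = 0 at he
  rwa [π.proj_coe] at he

/-- By the functional calculus, a self-adjoint operator that is not a scalar admits two non-zero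
operators with product zero, of which the first commutes with everything that it commutes with. -/
theorem exists_eq_smul_or_exists_mul_eq_zero {E : Type*} [NormedAddCommGroup E]
    [InnerProductSpace ℂ E] [CompleteSpace E] [Nontrivial E] {A : E →L[ℂ] E}
    (hA : IsSelfAdjoint A) : (∃ a : ℝ, A = a • (1 : E →L[ℂ] E)) ∨
      ∃ B C : E →L[ℂ] E, B ≠ 0 ∧ C ≠ 0 ∧ B * C = 0 ∧ ∀ D, Commute A D → Commute B D := by
  by_cases hsub : (spectrum ℝ A).Subsingleton
  · obtain ⟨a, ha⟩ : (spectrum ℝ A).Nonempty :=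
      ContinuousFunctionalCalculus.spectrum_nonempty A hA
    left
    refine ⟨a, ?_⟩
    rw [← Algebra.algebraMap_eq_smul_one]
    exact CFC.eq_algebraMap_of_spectrum_subset_singleton A a (fun b hb => hsub hb ha) hA
  · right
    obtain ⟨b, hb, c, hc, hbc⟩ : ∃ b ∈ spectrum ℝ A, ∃ c ∈ spectrum ℝ A, b < c := by
      obtain ⟨b, hb, c, hc, hne⟩ := Set.not_subsingleton_iff.1 hsub
      rcases hne.lt_or_gt with h | h
      · exact ⟨b, hb, c, hc, h⟩
      · exact ⟨c, hc, b, hb, h⟩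
    -- Cut the spectrum at the midpoint of `b` and `c`.
    let f : ℝ → ℝ := fun x => max (x - (b + c) / 2) 0
    let f' : ℝ → ℝ := fun x => max ((b + c) / 2 - x) 0
    have hf : Continuous f := by fun_prop
    have hf' : Continuous f' := by fun_prop
    have hne : ∀ f : ℝ → ℝ, Continuous f → ∀ x ∈ spectrum ℝ A, f x ≠ 0 → cfc f A ≠ 0 := by
      intro f hf x hx hfx h0
      rw [← cfc_const_zero ℝ A] at h0
      exact hfx ((cfc_eq_cfc_iff_eqOn (hf := hf.continuousOn)).1 h0 hx)
    refine ⟨cfc f A, cfc f' A, hne f hf c hc (lt_max_of_lt_left (by linarith)).ne',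
      hne f' hf' b hb (lt_max_of_lt_left (by linarith)).ne', ?_, fun D hD => hD.cfc_real f⟩
    rw [← cfc_mul f f' A hf.continuousOn hf'.continuousOn, ← cfc_const_zero ℝ A]
    congr 1
    funext x
    rcases le_total x ((b + c) / 2) with h | h
    · simp [f, max_eq_right (sub_nonpos.2 h)]
    · simp [f', max_eq_right (sub_nonpos.2 h)]

/-- If the Hecke operators are self-adjoint and commute, they act as scalars. -/
theorem UnitaryRep.IsIrreducible.exists_hecke_eq_smul {π : UnitaryRep G H}
    (hπ : π.IsIrreducible) {K : Subgroup G} (hsa : ∀ g, IsSelfAdjoint (π.hecke K g))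
    (hcomm : ∀ g h, Commute (π.hecke K g) (π.hecke K h)) [Nontrivial (π.invariants K)] (g : G) :
    ∃ c : ℂ, ∀ w, π.hecke K g w = c • w := by
  rcases exists_eq_smul_or_exists_mul_eq_zero (hsa g) with ⟨a, ha⟩ | ⟨B, C, hB, hC, hBC, hD⟩
  · refine ⟨(a : ℂ), fun w => ?_⟩
    rw [ha]
    simp
  · obtain ⟨e, he⟩ : ∃ e, C e ≠ 0 := by
      by_contra! h
      exact hC (ContinuousLinearMap.ext h)
    refine absurd (hπ.eq_zero_of_commute_hecke (fun h => hD _ (hcomm g h)) he ?_) hB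
    exact congrArg (fun B : π.invariants K →L[ℂ] π.invariants K => B e) hBC

/-- Vectors fixed by the stabilizer of `v` are unique up to scalars. -/
theorem UnitaryRep.IsIrreducible.exists_eq_smul {π : UnitaryRep G H}
    (hπ : π.IsIrreducible) {X : Type*} [MulAction G X] {v : X}
    (hfin : ∀ g : G, (MulAction.orbit (MulAction.stabilizer G v) (g • v)).Finite)
    (hK : ∀ g : G, ∃ k ∈ MulAction.stabilizer G v, ∃ k' ∈ MulAction.stabilizer G v,
      g⁻¹ = k * g * k') {ξ : H} (hξ : ξ ∈ π.invariants (MulAction.stabilizer G v)) (hξ0 : ξ ≠ 0)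
    {w : H} (hw : w ∈ π.invariants (MulAction.stabilizer G v)) : ∃ c : ℂ, w = c • ξ := by
  set K := MulAction.stabilizer G v
  let ξ' : π.invariants K := ⟨ξ, hξ⟩
  have hξ'0 : ξ' ≠ 0 := fun h => hξ0 (congrArg Subtype.val h)
  have : Nontrivial (π.invariants K) := ⟨ξ', 0, hξ'0⟩
  have htop : (Submodule.span ℂ {ξ'}).comap (π.proj K).toLinearMap = ⊤ := by
    refine hπ.eq_top_of_isClosed hξ0 ?_ fun g => ?_
    · exact (Submodule.closed_of_finiteDimensional (Submodule.span ℂ {ξ'})).preimage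
        (π.proj K).continuous
    · obtain ⟨c, hc⟩ := hπ.exists_hecke_eq_smul (π.isSelfAdjoint_hecke hK)
        (π.commute_hecke hfin hK) g
      exact Submodule.mem_span_singleton.2 ⟨c, (hc ξ').symm⟩
  have hmem : w ∈ (Submodule.span ℂ {ξ'}).comap (π.proj K).toLinearMap :=
    htop ▸ Submodule.mem_top
  obtain ⟨c, hc⟩ := Submodule.mem_span_singleton.1 hmem
  refine ⟨c, ?_⟩
  have h2 := π.proj_coe K ⟨w, hw⟩
  exact (congrArg Subtype.val (hc.trans h2)).symm

end Representation

/-! ### The spherical eigenfunction and finite-dimensionality -/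

section Eigenfunction

variable {V : Type u} {T : SimpleGraph V} {G : Subgroup (T ≃g T)} {H : Type w}
  [NormedAddCommGroup H] [InnerProductSpace ℂ H] [CompleteSpace H] (π : UnitaryRep G H)

open Classical in
/-- The vector-valued function on the tree attached to a vector `ξ` fixed by the stabilizer of
`v`: on the orbit of `v` it is `g • v ↦ π g ξ`, and at a vertex outside of the orbit it is the sum
of these values over the neighbours. It is meant for groups with at most two orbits of vertices, so
that the neighbours of a vertex outside of the orbit lie in the orbit. -/
noncomputable def UnitaryRep.eigenfunction (hfin : ∀ x, (T.neighborSet x).Finite) (v : V) (ξ : H)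
    (x : V) : H :=
  if x ∈ MulAction.orbit G v then π.vectorAt v ξ x
  else ∑ y ∈ (hfin x).toFinset, π.vectorAt v ξ y

/-- Summation over neighbours commutes with equivariance. -/
theorem UnitaryRep.sum_neighbors_smul (hfin : ∀ x, (T.neighborSet x).Finite) {f : V → H}
    (hf : ∀ (g : G) x, f (g • x) = π.op g (f x)) (g : G) (x : V) :
    ∑ y ∈ (hfin (g • x)).toFinset, f y = π.op g (∑ y ∈ (hfin x).toFinset, f y) := by
  rw [map_sum]
  symm
  refine Finset.sum_equiv (MulAction.toPerm g) (fun y => ?_) fun y _ => (hf g y).symm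
  rw [Set.Finite.mem_toFinset, Set.Finite.mem_toFinset]
  exact (smul_adj_iff g).symm

theorem UnitaryRep.eigenfunction_smul (hfin : ∀ x, (T.neighborSet x).Finite) {v : V} {ξ : H}
    (hξ : ξ ∈ π.invariants (MulAction.stabilizer G v)) (g : G) (x : V) :
    π.eigenfunction hfin v ξ (g • x) = π.op g (π.eigenfunction hfin v ξ x) := by
  rw [UnitaryRep.eigenfunction, UnitaryRep.eigenfunction]
  by_cases hx : x ∈ MulAction.orbit G v
  · rw [if_pos hx, if_pos ((smul_mem_orbit_iff g).2 hx), π.vectorAt_smul hξ]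
  · rw [if_neg hx, if_neg (mt (smul_mem_orbit_iff g).1 hx),
      π.sum_neighbors_smul hfin (π.vectorAt_smul hξ)]

theorem UnitaryRep.eigenfunction_smul_base (hfin : ∀ x, (T.neighborSet x).Finite) {v : V} {ξ : H}
    (hξ : ξ ∈ π.invariants (MulAction.stabilizer G v)) (g : G) :
    π.eigenfunction hfin v ξ (g • v) = π.op g ξ := by
  rw [UnitaryRep.eigenfunction, if_pos (MulAction.mem_orbit v g), π.vectorAt_smul_base hξ]

/-- At `v` the sum over the neighbours is again fixed by the stabilizer of `v`, hence a multiple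
of `ξ`, and equivariance carries this over to the orbit of `v`. Outside of the orbit the equation
holds by definition. -/
theorem UnitaryRep.exists_sum_eigenfunction_eq_smul (hfin : ∀ x, (T.neighborSet x).Finite) {v : V}
    {ξ : H} (hξ : ξ ∈ π.invariants (MulAction.stabilizer G v))
    (huniq : ∀ w ∈ π.invariants (MulAction.stabilizer G v), ∃ c : ℂ, w = c • ξ)
    (horb : ∀ x y, x ∉ MulAction.orbit G v → T.Adj x y → y ∈ MulAction.orbit G v) :
    ∃ c : V → ℂ, ∀ x, ∑ y ∈ (hfin x).toFinset, π.eigenfunction hfin v ξ y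
      = c x • π.eigenfunction hfin v ξ x := by
  have hsum := π.sum_neighbors_smul hfin (π.eigenfunction_smul hfin hξ)
  suffices h : ∀ x, ∃ c : ℂ, ∑ y ∈ (hfin x).toFinset, π.eigenfunction hfin v ξ y
      = c • π.eigenfunction hfin v ξ x from ⟨fun x => (h x).choose, fun x => (h x).choose_spec⟩
  intro x
  by_cases hx : x ∈ MulAction.orbit G v
  · obtain ⟨g, rfl⟩ := hx
    obtain ⟨c, hc⟩ := huniq (∑ y ∈ (hfin v).toFinset, π.eigenfunction hfin v ξ y) fun k hk => by
      have := hsum k v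
      rw [MulAction.mem_stabilizer_iff.1 hk] at this
      exact this.symm
    refine ⟨c, ?_⟩
    change ∑ y ∈ (hfin (g • v)).toFinset, _ = c • π.eigenfunction hfin v ξ (g • v)
    rw [hsum, hc, map_smul, π.eigenfunction_smul_base hfin hξ]
  · refine ⟨1, ?_⟩
    rw [one_smul]
    conv_rhs => rw [UnitaryRep.eigenfunction, if_neg hx]
    refine Finset.sum_congr rfl fun y hy => ?_
    rw [UnitaryRep.eigenfunction, if_pos (horb x y hx (by simpa using hy))]

end Eigenfunction

end TreeRep

theorem mainTheorem9 {V : Type u} (T : SimpleGraph V) (d₀ d₁ : ℕ)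
    (hd₀ : 3 ≤ d₀) (hd₁ : 3 ≤ d₁) (hT : TreeRep.IsSemiRegularTree T d₀ d₁)
    (G : Subgroup (T ≃g T)) (hclosed : IsClosed (G : Set (T ≃g T)))
    (hnoncompact : ¬ IsCompact (G : Set (T ≃g T)))
    (hboundary : MulAction.IsPretransitive G (TreeRep.Boundary T)) (v : V)
    (n : ℕ) (hn : 1 ≤ n) :
    ∃ k : ℕ, ∀ (H : Type w) [NormedAddCommGroup H] [InnerProductSpace ℂ H] [CompleteSpace H]
      [TopologicalSpace.SeparableSpace H] (π : TreeRep.UnitaryRep G H),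
      TreeRep.IsSpherical π →
      π.invariants (MulAction.stabilizer G v) ≠ ⊥ →
      Module.rank ℂ (π.invariants (fixingSubgroup G (TreeRep.closedBall T v n))) < k := by
  classical
  obtain ⟨hT, V₀, V₁, hV⟩ := hT
  have hdeg : ∀ x, ∃ d : ℕ, 3 ≤ d ∧ (T.neighborSet x).encard = d := by
    intro x
    rcases hV.cover.symm ▸ Set.mem_univ x with hx | hx
    · exact ⟨d₀, hd₀, hV.degree₀ x hx⟩
    · exact ⟨d₁, hd₁, hV.degree₁ x hx⟩
  have hfin : ∀ x, (T.neighborSet x).Finite := fun x => by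
    obtain ⟨d, -, h⟩ := hdeg x
    exact Set.finite_of_encard_eq_coe h
  have h3 : ∀ x, 3 ≤ (T.neighborSet x).encard := fun x => by
    obtain ⟨d, hd, h⟩ := hdeg x
    rw [h]
    exact_mod_cast hd
  have hS : ∀ y a b : V, T.dist y a = T.dist y b →
      ∃ g ∈ MulAction.stabilizer G y, g • a = b := fun y a b =>
    TreeRep.exists_mem_stabilizer_smul_eq hT hfin h3 hboundary hclosed hnoncompact
  -- A stabilizer is transitive on spheres, so its orbits are finite and `g⁻¹ ∈ KgK`.
  have horbfin : ∀ g : G, (MulAction.orbit (MulAction.stabilizer G v) (g • v)).Finite := by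
    intro g
    refine (TreeRep.finite_closedBall hT hfin v (T.dist v (g • v))).subset ?_
    rintro _ ⟨⟨k, hk⟩, rfl⟩
    have := TreeRep.dist_smul hT k v (g • v)
    rw [MulAction.mem_stabilizer_iff.1 hk] at this
    exact this.le
  have hgelfand : ∀ g : G, ∃ k ∈ MulAction.stabilizer G v, ∃ k' ∈ MulAction.stabilizer G v,
      g⁻¹ = k * g * k' := by
    intro g
    obtain ⟨k, hk, hkg⟩ := hS v (g • v) (g⁻¹ • v) (by
      rw [← TreeRep.dist_smul hT g v (g⁻¹ • v), smul_inv_smul, T.dist_comm])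
    refine ⟨k, hk, (k * g)⁻¹ * g⁻¹, ?_, by group⟩
    rw [MulAction.mem_stabilizer_iff, mul_smul, ← hkg, ← mul_smul k, inv_smul_smul]
  set L := fixingSubgroup G (TreeRep.closedBall T v n)
  have hL : L ≤ MulAction.stabilizer G v := fun g hg =>
    (mem_fixingSubgroup_iff G).1 hg v (by simp [TreeRep.closedBall])
  have := TreeRep.countable_of_locallyFinite hT hfin v
  have : Countable (G ⧸ L) :=
    TreeRep.countable_quotient_fixingSubgroup (TreeRep.finite_closedBall hT hfin v n)
  obtain ⟨M, hM⟩ := TreeRep.exists_level_conjugate hT hfin h3 hboundary L hL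
  have hB := TreeRep.finite_closedBall hT hfin v (M + 1)
  refine ⟨hB.toFinset.card + 1, fun H _ _ _ _ π hπ hne => ?_⟩
  obtain ⟨ξ, hξ, hξ0⟩ := (Submodule.ne_bot_iff _).1 hne
  obtain ⟨c, hc⟩ := π.exists_sum_eigenfunction_eq_smul hfin hξ
    (fun w hw => hπ.1.exists_eq_smul horbfin hgelfand hξ hξ0 hw)
    (fun x y hx hxy => TreeRep.mem_orbit_of_adj hT hS hx hxy)
  let F : V → π.invariants L := fun x => π.proj L (π.eigenfunction hfin v ξ x)
  have hF : ∀ x, F x ∈ Submodule.span ℂ (F '' TreeRep.closedBall T v (M + 1)) := by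
    refine TreeRep.mem_span_of_eigenfunction hT hfin L hM F c (fun h hh x => ?_) fun x => ?_
    · change π.proj L _ = π.proj L _
      rw [π.eigenfunction_smul hfin hξ, π.proj_op hh]
    · change _ = c x • π.proj L _
      rw [← map_smul, ← hc, map_sum]
  set W := Submodule.span ℂ (F '' TreeRep.closedBall T v (M + 1)) with hW
  have : FiniteDimensional ℂ W := FiniteDimensional.span_of_finite ℂ (hB.image F)
  -- The preimage of `W` is a closed subspace containing the translates of the cyclic vector `ξ`.
  have htop : W.comap (π.proj L).toLinearMap = ⊤ := by
    refine hπ.1.eq_top_of_isClosed hξ0 ?_ fun g => ?_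
    · exact (Submodule.closed_of_finiteDimensional W).preimage (π.proj L).continuous
    · rw [← π.eigenfunction_smul_base hfin hξ g]
      exact hF (g • v)
  have hWtop : W = ⊤ := by
    refine eq_top_iff.2 fun e _ => ?_
    have he : (e : H) ∈ W.comap (π.proj L).toLinearMap := htop ▸ Submodule.mem_top
    rw [← π.proj_coe L e]
    exact he
  have hcoe : ((hB.toFinset.image F : Finset _) : Set _) = F '' TreeRep.closedBall T v (M + 1) := by
    rw [Finset.coe_image, hB.coe_toFinset]
  have hrank : Module.rank ℂ (π.invariants L) ≤ (hB.toFinset.image F).card := by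
    rw [← rank_top, ← hWtop, hW, ← hcoe]
    exact rank_span_finset_le _
  refine lt_of_le_of_lt (hrank.trans (Nat.cast_le.2 Finset.card_image_le)) ?_
  exact_mod_cast Nat.lt_succ_self _
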